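/- **Theorem 5.1.** For every $n\in\mathbb N$ let $H_n$ be a Hamiltonian on $n$ qubits, normalized so that $\|H_n\|=1$ in operator norm, and suppose that $H_n$ is a commuting $k(n)$-local Hamiltonian with $k(n)=O(\log n)$: $H_n=\sum_j H_{n,j}$ is a finite sum of Hermitian terms with $[H_{n,i},H_{n,j}]=0$ for all $i,j$, where $H_{n,j}$ acts as the identity outside a set $S_{n,j}$ of at most $k(n)$ qubits. Suppose also that the number of different sets among the $S_{n,j}$ is at most polynomial in $n$ (this is automatic if $k(n)=O(1)$). Then for every $T(n)=2^{\Omega(n)}$ and every positive $\alpha(n)=2^{-\Omega(n)}$ the family $(H_n)$ can be $(T,\alpha)$-fast forwarded. Here $(H_n)$ *can be $(T,\alpha)$-fast forwarded* if there is a polynomial $p$ such that for every $n$ and every $t$ with $0\le t\le T(n)$ there are a number $c\le p(n)$ of ancilla qubits and a quantum circuit $\widetilde U$ on $n+c$ qubits, consisting of at most $p(n)$ gates, each an arbitrary unitary acting on at most two qubits, with $$\big\|\big(e^{-iH_nt}\otimes \mathbb 1_{2^c}-\widetilde U\big)\,|\psi\rangle\otimes|0^c\rangle\big\|\le\alpha(n)\qquad\text{for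 every } n\text{-qubit unit vector } |\psi\rangle .$$ -/

import Mathlib

open scoped Kronecker Matrix

noncomputable section

namespace FastForward

/-- Labels of the computational basis of a register whose qubits are labelled by `Q`. -/
abbrev Bits (Q : Type) : Type := Q → Fin 2

/-- Operators on a register of qubits labelled by `Q`, written in the computational basis. -/
abbrev Op (Q : Type) : Type := Matrix (Bits Q) (Bits Q) ℂ

/-- State vectors of a register of qubits labelled by `Q`, with the Euclidean norm. -/
abbrev Ket (Q : Type) : Type := EuclideanSpace ℂ (Bits Q)

/-- The operator `A ⊗ 1`: `A` acts on the qubits in `S`, the identity on all the others. -/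
def localOp {Q : Type} [Fintype Q] [DecidableEq Q] (S : Finset Q)
    (A : Op {q : Q // q ∈ S}) : Op Q :=
  (A ⊗ₖ (1 : Op {q : Q // ¬ q ∈ S})).submatrix
    (Equiv.piEquivPiSubtypeProd (fun q => q ∈ S) (fun _ => Fin 2))
    (Equiv.piEquivPiSubtypeProd (fun q => q ∈ S) (fun _ => Fin 2))

/-- `M` acts trivially on every qubit outside `S`. -/
def ActsOn {Q : Type} [Fintype Q] [DecidableEq Q] (S : Finset Q) (M : Op Q) : Prop :=
  ∃ A : Op {q : Q // q ∈ S}, M = localOp S A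

/-- A quantum gate: an arbitrary unitary on at most two of the qubits of the register. -/
structure Gate (Q : Type) [Fintype Q] [DecidableEq Q] where
  /-- the qubits that the gate touches -/
  wires : Finset Q
  card_wires : wires.card ≤ 2
  /-- the unitary that is applied to these qubits -/
  mat : Op {q : Q // q ∈ wires}
  unitary : mat ∈ Matrix.unitaryGroup (Bits {q : Q // q ∈ wires}) ℂ

/-- A quantum circuit: a list of gates, the head of which is applied first. Its complexity is
the number of its gates, that is the length of the list. -/
abbrev Circuit (Q : Type) [Fintype Q] [DecidableEq Q] : Type := List (Gate Q)

/-- The operator on the whole register that a circuit implements. -/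
def Circuit.toOp {Q : Type} [Fintype Q] [DecidableEq Q] : Circuit Q → Op Q
  | [] => 1
  | g :: C => Circuit.toOp C * localOp g.wires g.mat

/-- The action of an operator on a state vector. -/
def applyOp {Q : Type} [Fintype Q] [DecidableEq Q] (M : Op Q) (ψ : Ket Q) : Ket Q :=
  Matrix.toEuclideanCLM (𝕜 := ℂ) M ψ

/-- The operator norm of an operator for the Euclidean norm on states. -/
def opNorm {Q : Type} [Fintype Q] [DecidableEq Q] (M : Op Q) : ℝ :=
  ‖Matrix.toEuclideanCLM (𝕜 := ℂ) M‖

/-- The operator `M ⊗ 1` on `n` qubits together with `c` ancilla qubits. -/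
def withAncilla {n : ℕ} (c : ℕ) (M : Op (Fin n)) : Op (Fin n ⊕ Fin c) :=
  (M ⊗ₖ (1 : Op (Fin c))).submatrix
    (Equiv.sumArrowEquivProdArrow (Fin n) (Fin c) (Fin 2))
    (Equiv.sumArrowEquivProdArrow (Fin n) (Fin c) (Fin 2))

/-- The state `|ψ⟩ ⊗ |0⟩` with `c` ancilla qubits in the state `0`. -/
def ketZero {n : ℕ} (c : ℕ) (ψ : Ket (Fin n)) : Ket (Fin n ⊕ Fin c) :=
  WithLp.toLp 2 fun x =>
    if ∀ j : Fin c, x (Sum.inr j) = 0 then ψ (fun i => x (Sum.inl i)) else 0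

/-- The time evolution `exp (-i H t)`. -/
def evolution {n : ℕ} (H : Op (Fin n)) (t : ℝ) : Op (Fin n) :=
  NormedSpace.exp ((-(Complex.I * (t : ℂ))) • H)

/-- A presentation of `H` as a commuting `k`-local Hamiltonian: a finite sum of pairwise commuting
Hermitian terms, each of which acts non-trivially on at most `k` qubits. -/
structure CommutingLocal {n : ℕ} (H : Op (Fin n)) (k : ℕ) where
  /-- the number of terms -/
  m : ℕ
  /-- the terms -/
  term : Fin m → Op (Fin n)
  /-- the qubits on which each term acts -/
  supp : Fin m → Finset (Fin n)
  sum_eq : H = ∑ j, term j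
  isHermitian : ∀ j, (term j).IsHermitian
  commute : ∀ i j, Commute (term i) (term j)
  actsOn : ∀ j, ActsOn (supp j) (term j)
  card_supp : ∀ j, (supp j).card ≤ k

/-- The number of different sets of qubits on which the terms act. -/
def CommutingLocal.numSupports {n : ℕ} {H : Op (Fin n)} {k : ℕ} (D : CommutingLocal H k) : ℕ :=
  (Finset.univ.image D.supp).card

/-- The family of Hamiltonians `H n` on `n` qubits can be `(T, α)`-fast forwarded: up to time `T n`
the evolution is implemented to within error `α n`, on every state, by a circuit whose number of
gates and of ancilla qubits is at most polynomial in `n`. -/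
def FastForwardable (H : ∀ n : ℕ, Op (Fin n)) (T α : ℕ → ℝ) : Prop :=
  ∃ p : Polynomial ℕ, ∀ n : ℕ, ∀ t : ℝ, 0 ≤ t → t ≤ T n →
    ∃ c : ℕ, c ≤ p.eval n ∧ ∃ U : Circuit (Fin n ⊕ Fin c), U.length ≤ p.eval n ∧
      ∀ ψ : Ket (Fin n), ‖ψ‖ = 1 →
        ‖applyOp (withAncilla c (evolution (H n) t) - U.toOp) (ketZero c ψ)‖ ≤ α n

/-- `T = 2 ^ Ω(n)`. -/
def ExpLarge (T : ℕ → ℝ) : Prop :=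
  ∃ a : ℝ, 0 < a ∧ ∀ᶠ n : ℕ in Filter.atTop, (2 : ℝ) ^ (a * (n : ℝ)) ≤ T n

/-- `α` is positive and `α = 2 ^ (-Ω(n))`. -/
def ExpSmall (α : ℕ → ℝ) : Prop :=
  (∀ n, 0 < α n) ∧
    ∃ a : ℝ, 0 < a ∧ ∀ᶠ n : ℕ in Filter.atTop, α n ≤ (2 : ℝ) ^ (-(a * (n : ℝ)))

end FastForward

end

/-!
# Fast forwarding of commuting local Hamiltonians

The terms with the same support `S` add up to a Hermitian operator `H_S` on the qubits in `S`, and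
the `H_S` commute. Hence `exp (-i H t)` is the product of the `exp (-i H_S t)`
(`CommutingLocal.realizable_evolution`): polynomially many unitaries, each on `k = O(log n)` qubits.
The time `t` enters through the gates only, not through their number. Since gates are arbitrary
unitaries on two qubits, every unitary on `k` qubits is implemented exactly and without ancillas by
at most `7 * 40 ^ k` of them (`realizable_of_unitary`), which is polynomial in `n`
(`exists_polynomial_bound`). So the circuit has no error at all, and neither the size of `T` nor the
decay of `α` matters.

The exact synthesis rests on three facts.

* A phase controlled by `m` bits is a product of phases controlled by `m - 1` bits, and two
  controlled NOTs (`phaseOn_insert_insert`), because `2 A B = A + B - (A xor B)` for bits. Hence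
  `5 ^ m` gates suffice.
* A reflection `1 - 2 |w⟩⟨w|` with `w` supported on two basis states that differ in one qubit is a
  controlled phase conjugated by a rotation of that qubit. For other pairs of basis states, swaps of
  adjacent basis states reduce the Hamming distance; they are such reflections themselves
  (`realizable_reflection_pairVec`).
* Householder elimination with these reflections, column by column, turns a unitary into a diagonal
  one (`realizable_of_diagonal_columns`), which is a product of phases.

Everything is done on an arbitrary register; `liftOp` embeds it into a larger one. Both `A ⊗ 1` in
`localOp` and in `withAncilla 0` are instances of `liftOp`.
-/

open scoped Kronecker Matrix

noncomputable section

-- the instances on a register are declared once for the whole file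
set_option linter.unusedSectionVars false

namespace FastForward

variable {Q Q' Q'' : Type} [Fintype Q] [DecidableEq Q] [Fintype Q'] [DecidableEq Q']
  [Fintype Q''] [DecidableEq Q'']

/-! ### Operators on part of a register -/

open Classical in
/-- The operator `M` acting on the qubits `ι q` of a larger register, and as the identity on the
qubits outside the range of `ι`. It is meant for injective `ι`. -/
def liftOp (ι : Q → Q') (M : Op Q) : Op Q' :=
  Matrix.of fun x y => if ∀ q ∉ Set.range ι, x q = y q then M (x ∘ ι) (y ∘ ι) else 0

lemma liftOp_apply (ι : Q → Q') (M : Op Q) (x y : Bits Q')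
    [Decidable (∀ q ∉ Set.range ι, x q = y q)] :
    liftOp ι M x y = if ∀ q ∉ Set.range ι, x q = y q then M (x ∘ ι) (y ∘ ι) else 0 := by
  simp only [liftOp, Matrix.of_apply]
  congr

lemma eq_of_comp_eq {ι : Q → Q'} {x y : Bits Q'} (h : ∀ q ∉ Set.range ι, x q = y q)
    (h' : x ∘ ι = y ∘ ι) : x = y := by
  funext q
  by_cases hq : q ∈ Set.range ι
  · obtain ⟨r, rfl⟩ := hq
    exact congrFun h' r
  · exact h q hq

lemma liftOp_one (ι : Q → Q') : liftOp ι 1 = 1 := by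
  classical
  ext x y
  rw [liftOp_apply]
  simp only [Matrix.one_apply]
  by_cases hxy : x = y
  · simp [hxy]
  · rw [if_neg hxy]
    split_ifs with h h'
    · exact (hxy (eq_of_comp_eq h h')).elim
    · rfl
    · rfl

lemma liftOp_mul {ι : Q → Q'} (hι : ι.Injective) (M N : Op Q) :
    liftOp ι (M * N) = liftOp ι M * liftOp ι N := by
  classical
  ext x y
  rw [Matrix.mul_apply, liftOp_apply]
  symm
  -- the intermediate basis states that contribute agree with `y` off the range of `ι`
  rw [← Fintype.sum_of_injective (fun u : Bits Q => (Function.extend ι u y : Bits Q')) ?_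
    (fun u => if ∀ q ∉ Set.range ι, x q = y q then M (x ∘ ι) u * N u (y ∘ ι) else 0) _ ?_ ?_]
  · split_ifs with h
    · rw [Matrix.mul_apply]
    · simp
  · intro u v huv
    funext q
    simpa [hι.extend_apply] using congrFun huv (ι q)
  · intro z hz
    rw [liftOp_apply ι N, if_neg, mul_zero]
    intro h
    refine hz ⟨z ∘ ι, ?_⟩
    refine eq_of_comp_eq (ι := ι) (fun q hq => ?_) (Function.extend_comp hι _ _)
    simp only
    rw [Function.extend_apply' _ _ _ (by simpa using hq), h q hq]
  · intro u
    have h1 : Function.extend ι u y ∘ ι = u := Function.extend_comp hι _ _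
    have h2 : ∀ q ∉ Set.range ι, Function.extend ι u y q = y q := fun q hq =>
      Function.extend_apply' _ _ _ (by simpa using hq)
    rw [liftOp_apply, liftOp_apply, h1, if_pos h2]
    have h3 : (∀ q ∉ Set.range ι, x q = Function.extend ι u y q) ↔
        ∀ q ∉ Set.range ι, x q = y q :=
      forall₂_congr fun q hq => by rw [h2 q hq]
    simp only [h3]
    split_ifs <;> simp

lemma liftOp_conjTranspose (ι : Q → Q') (M : Op Q) : liftOp ι Mᴴ = (liftOp ι M)ᴴ := by
  classical
  ext x y
  simp only [Matrix.conjTranspose_apply, liftOp_apply, eq_comm (a := x _)]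
  split_ifs <;> simp

lemma liftOp_add (ι : Q → Q') (M N : Op Q) : liftOp ι (M + N) = liftOp ι M + liftOp ι N := by
  classical
  ext x y
  simp only [Matrix.add_apply, liftOp_apply]
  split_ifs <;> simp

lemma liftOp_smul (ι : Q → Q') (c : ℂ) (M : Op Q) : liftOp ι (c • M) = c • liftOp ι M := by
  classical
  ext x y
  simp only [Matrix.smul_apply, liftOp_apply]
  split_ifs <;> simp

lemma liftOp_injective {ι : Q → Q'} (hι : ι.Injective) :
    Function.Injective (liftOp ι : Op Q → Op Q') := by
  classical
  intro M N h
  ext u v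
  have he : ∀ w : Bits Q, (Function.extend ι w 0 : Bits Q') ∘ ι = w :=
    fun w => Function.extend_comp hι _ _
  have h' := congrFun (congrFun h (Function.extend ι u 0)) (Function.extend ι v 0)
  rw [liftOp_apply, liftOp_apply, he, he, if_pos, if_pos] at h'
  · exact h'
  all_goals
    intro q hq
    rw [Function.extend_apply' _ _ _ (by simpa using hq),
      Function.extend_apply' _ _ _ (by simpa using hq)]

/-- Extension to a larger register as a homomorphism of algebras. -/
def liftOpHom {ι : Q → Q'} (hι : ι.Injective) : Op Q →ₐ[ℂ] Op Q' :=
  AlgHom.ofLinearMap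
    { toFun := liftOp ι
      map_add' := liftOp_add ι
      map_smul' := liftOp_smul ι }
    (liftOp_one ι) (liftOp_mul hι)

lemma liftOp_liftOp {κ : Q' → Q''} (hκ : κ.Injective) (ι : Q → Q') (M : Op Q) :
    liftOp κ (liftOp ι M) = liftOp (κ ∘ ι) M := by
  classical
  ext x y
  simp only [liftOp_apply]
  by_cases h : ∀ q ∉ Set.range (κ ∘ ι), x q = y q
  · rw [if_pos h, if_pos, if_pos]
    · rfl
    · intro q hq
      refine h _ ?_
      rintro ⟨r, hr⟩
      exact hq ⟨r, hκ hr⟩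
    · intro q hq
      refine h _ ?_
      rintro ⟨r, rfl⟩
      exact hq ⟨_, rfl⟩
  · rw [if_neg h]
    split_ifs with h1 h2
    · exfalso
      apply h
      intro q hq
      by_cases hq' : q ∈ Set.range κ
      · obtain ⟨r, rfl⟩ := hq'
        refine h2 r ?_
        rintro ⟨s, rfl⟩
        exact hq ⟨s, rfl⟩
      · exact h1 q hq'
    · rfl
    · rfl

lemma localOp_eq_liftOp (S : Finset Q) (A : Op {q : Q // q ∈ S}) :
    localOp S A = liftOp Subtype.val A := by
  classical
  ext x y
  rw [liftOp_apply]
  simp only [localOp, Matrix.submatrix_apply, Matrix.kroneckerMap_apply, Matrix.one_apply,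
    mul_ite, mul_one, mul_zero]
  refine if_congr ?_ rfl rfl
  simp [funext_iff, Equiv.piEquivPiSubtypeProd]

lemma withAncilla_zero_eq_liftOp {n : ℕ} (M : Op (Fin n)) :
    withAncilla 0 M = liftOp (Sum.inl : Fin n → Fin n ⊕ Fin 0) M := by
  classical
  ext x y
  rw [liftOp_apply, if_pos]
  · simp only [withAncilla, Matrix.submatrix_apply, Matrix.kroneckerMap_apply]
    rw [Subsingleton.elim ((Equiv.sumArrowEquivProdArrow (Fin n) (Fin 0) (Fin 2)) x).2
      ((Equiv.sumArrowEquivProdArrow (Fin n) (Fin 0) (Fin 2)) y).2]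
    simp [Equiv.sumArrowEquivProdArrow]
  · rintro (q | q) hq
    · exact (hq ⟨q, rfl⟩).elim
    · exact q.elim0

/-! ### Circuits -/

lemma Circuit.toOp_append (C C' : Circuit Q) :
    Circuit.toOp (C ++ C') = Circuit.toOp C' * Circuit.toOp C := by
  induction C with
  | nil => simp [Circuit.toOp]
  | cons g C ih => simp [Circuit.toOp, ih, mul_assoc]

/-- The operator `M` is implemented exactly, without ancillas, by a circuit of at most `N` gates. -/
def Realizable (M : Op Q) (N : ℕ) : Prop :=
  ∃ C : Circuit Q, C.length ≤ N ∧ C.toOp = M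

namespace Realizable

lemma mono {M : Op Q} {N N' : ℕ} (h : Realizable M N) (hN : N ≤ N') : Realizable M N' := by
  obtain ⟨C, hC, rfl⟩ := h
  exact ⟨C, hC.trans hN, rfl⟩

lemma one : Realizable (1 : Op Q) 0 := ⟨[], le_rfl, rfl⟩

lemma mul {M M' : Op Q} {N N' : ℕ} (h : Realizable M N) (h' : Realizable M' N') :
    Realizable (M * M') (N + N') := by
  obtain ⟨C, hC, rfl⟩ := h
  obtain ⟨C', hC', rfl⟩ := h'
  refine ⟨C' ++ C, ?_, Circuit.toOp_append _ _⟩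
  rw [List.length_append]
  omega

/-- An operator on at most two qubits that is a unitary is a single gate, however these qubits are
embedded in the register. -/
lemma liftOp_unitary {ι : Q → Q'} (hι : ι.Injective) (hQ : Fintype.card Q ≤ 2) {A : Op Q}
    (hA : A ∈ Matrix.unitaryGroup (Bits Q) ℂ) : Realizable (liftOp ι A) 1 := by
  let w : Finset Q' := Finset.univ.map ⟨ι, hι⟩
  let κ : Q → {q : Q' // q ∈ w} := fun q => ⟨ι q, by simp [w]⟩
  have hκ : κ.Injective := fun a b h => hι (congrArg Subtype.val h)
  have hu : liftOp κ A ∈ Matrix.unitaryGroup (Bits {q : Q' // q ∈ w}) ℂ := by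
    rw [Matrix.mem_unitaryGroup_iff, Matrix.star_eq_conjTranspose] at hA ⊢
    rw [← liftOp_conjTranspose, ← liftOp_mul hκ, hA, liftOp_one]
  refine ⟨[⟨w, by simpa [w] using hQ, liftOp κ A, hu⟩], le_rfl, ?_⟩
  simp only [Circuit.toOp, one_mul]
  rw [localOp_eq_liftOp, liftOp_liftOp Subtype.val_injective]
  rfl

lemma conjTranspose {M : Op Q} {N : ℕ} (h : Realizable M N) : Realizable Mᴴ N := by
  obtain ⟨C, hC, rfl⟩ := h
  refine mono ?_ hC
  clear hC
  induction C with
  | nil => simpa [Circuit.toOp] using one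
  | cons g C ih =>
    simp only [Circuit.toOp, Matrix.conjTranspose_mul, List.length_cons]
    rw [add_comm, localOp_eq_liftOp, ← liftOp_conjTranspose]
    exact (liftOp_unitary Subtype.val_injective (by simpa using g.card_wires)
      (Unitary.star_mem g.unitary)).mul ih

lemma liftOp {M : Op Q} {N : ℕ} {ι : Q → Q'} (hι : ι.Injective) (h : Realizable M N) :
    Realizable (FastForward.liftOp ι M) N := by
  obtain ⟨C, hC, rfl⟩ := h
  refine mono ?_ hC
  clear hC
  induction C with
  | nil => simpa [Circuit.toOp, liftOp_one] using one
  | cons g C ih =>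
    simp only [Circuit.toOp, List.length_cons]
    rw [liftOp_mul hι, localOp_eq_liftOp, liftOp_liftOp hι]
    exact ih.mul (liftOp_unitary (hι.comp Subtype.val_injective) (by simpa using g.card_wires)
      g.unitary)

end Realizable

/-! ### Controlled phases -/

/-- The basis state `z` with the bit `b` flipped if the bit `a` has the value `v`. -/
def cnotMap (a b : Q) (v : Fin 2) (z : Bits Q) : Bits Q :=
  if z a = v then Function.update z b (z b + 1) else z

lemma cnotMap_apply_of_ne {a b : Q} {v : Fin 2} {z : Bits Q} {q : Q} (hq : q ≠ b) :
    cnotMap a b v z q = z q := by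
  unfold cnotMap
  split_ifs <;> simp [hq]

lemma cnotMap_apply_target (a b : Q) (v : Fin 2) (z : Bits Q) :
    cnotMap a b v z b = if z a = v then z b + 1 else z b := by
  unfold cnotMap
  split_ifs <;> simp

lemma cnotMap_involutive {a b : Q} (hab : a ≠ b) (v : Fin 2) :
    Function.Involutive (cnotMap a b v) := by
  intro z
  funext q
  by_cases hq : q = b
  · subst hq
    rw [cnotMap_apply_target, cnotMap_apply_of_ne hab, cnotMap_apply_target]
    split_ifs
    · rw [add_assoc, show (1 + 1 : Fin 2) = 0 from rfl, add_zero]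
    · rfl
  · rw [cnotMap_apply_of_ne hq, cnotMap_apply_of_ne hq]

/-- The controlled NOT gate with control `a` and target `b`, active if the control has the
value `v`. -/
def cnot (a b : Q) (v : Fin 2) : Op Q :=
  Matrix.of fun x y => if x = cnotMap a b v y then 1 else 0

lemma cnot_conj_diagonal {a b : Q} (hab : a ≠ b) (v : Fin 2) (d : Bits Q → ℂ) :
    cnot a b v * Matrix.diagonal d * cnot a b v = Matrix.diagonal (d ∘ cnotMap a b v) := by
  ext x y
  have hinv := cnotMap_involutive hab v
  rw [Matrix.mul_apply, Finset.sum_eq_single (cnotMap a b v y)]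
  · rw [Matrix.mul_diagonal]
    by_cases hxy : x = y
    · simp [cnot, hinv y, hxy]
    · simp [cnot, hinv y, hxy]
  · intro z _ hz
    simp [cnot, hz]
  · simp

lemma cnot_mul_self {a b : Q} (hab : a ≠ b) (v : Fin 2) : cnot a b v * cnot a b v = 1 := by
  simpa [Function.comp_def] using cnot_conj_diagonal hab v (fun _ => 1)

lemma cnot_conjTranspose {a b : Q} (hab : a ≠ b) (v : Fin 2) :
    (cnot a b v)ᴴ = cnot a b v := by
  ext x y
  have : y = cnotMap a b v x ↔ x = cnotMap a b v y :=
    ⟨fun h => by rw [h, cnotMap_involutive hab v], fun h => by rw [h, cnotMap_involutive hab v]⟩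
  simp only [cnot, Matrix.conjTranspose_apply, Matrix.of_apply, this]
  split_ifs <;> simp

lemma liftOp_cnot {ι : Q → Q'} (hι : ι.Injective) (a b : Q) (v : Fin 2) :
    liftOp ι (cnot a b v) = cnot (ι a) (ι b) v := by
  classical
  have hcomp : ∀ y : Bits Q', cnotMap a b v (y ∘ ι) = cnotMap (ι a) (ι b) v y ∘ ι := by
    intro y
    funext q
    by_cases hq : q = b
    · subst hq
      simp only [Function.comp_apply, cnotMap_apply_target]
    · simp only [Function.comp_apply]
      rw [cnotMap_apply_of_ne hq, cnotMap_apply_of_ne (hι.ne hq)]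
      rfl
  have hout : ∀ y : Bits Q', ∀ q ∉ Set.range ι, cnotMap (ι a) (ι b) v y q = y q := fun y q hq =>
    cnotMap_apply_of_ne fun h => hq ⟨b, h.symm⟩
  ext x y
  rw [liftOp_apply]
  simp only [cnot, Matrix.of_apply, hcomp]
  by_cases h : x = cnotMap (ι a) (ι b) v y
  · rw [if_pos h, if_pos, if_pos]
    · rw [h]
    · rw [h]
      exact hout y
  · rw [if_neg h]
    split_ifs with h1 h2
    · refine (h (eq_of_comp_eq (fun q hq => ?_) h2)).elim
      rw [h1 q hq, hout y q hq]
    · rfl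
    · rfl

lemma realizable_cnot {a b : Q} (hab : a ≠ b) (v : Fin 2) : Realizable (cnot a b v) 1 := by
  have hι : Function.Injective (fun i : Bool => if i then a else b) := by
    intro i j
    cases i <;> cases j <;> simp [hab, hab.symm]
  have h := Realizable.liftOp_unitary hι (by simp) (A := cnot true false v) (by
    rw [Matrix.mem_unitaryGroup_iff, Matrix.star_eq_conjTranspose, cnot_conjTranspose (by simp),
      cnot_mul_self (by simp)])
  rwa [liftOp_cnot hι] at h

/-- A single-qubit operator acting on the qubit `q`. -/
def oneQubit (q : Q) (A : Matrix (Fin 2) (Fin 2) ℂ) : Op Q :=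
  liftOp (fun _ : Unit => q) (A.submatrix (fun x => x ()) (fun x => x ()))

lemma oneQubit_apply (q : Q) (A : Matrix (Fin 2) (Fin 2) ℂ) (x y : Bits Q) :
    oneQubit q A x y = if ∀ r, r ≠ q → x r = y r then A (x q) (y q) else 0 := by
  rw [oneQubit, liftOp_apply]
  simp [eq_comm]

lemma submatrix_mem_unitaryGroup {A : Matrix (Fin 2) (Fin 2) ℂ}
    (hA : A ∈ Matrix.unitaryGroup (Fin 2) ℂ) :
    (A.submatrix (fun x => x ()) (fun x => x ()) : Op Unit) ∈
      Matrix.unitaryGroup (Bits Unit) ℂ := by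
  rw [Matrix.mem_unitaryGroup_iff, Matrix.star_eq_conjTranspose] at hA ⊢
  have := Matrix.submatrix_mul_equiv A Aᴴ (fun x : Bits Unit => x ())
    (Equiv.funUnique Unit (Fin 2)) (fun x : Bits Unit => x ())
  rw [hA] at this
  exact this.trans (Matrix.submatrix_one_equiv (Equiv.funUnique Unit (Fin 2)))

lemma oneQubit_mem_unitaryGroup (q : Q) {A : Matrix (Fin 2) (Fin 2) ℂ}
    (hA : A ∈ Matrix.unitaryGroup (Fin 2) ℂ) :
    oneQubit q A ∈ Matrix.unitaryGroup (Bits Q) ℂ := by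
  have := submatrix_mem_unitaryGroup hA
  rw [Matrix.mem_unitaryGroup_iff, Matrix.star_eq_conjTranspose] at this ⊢
  rw [oneQubit, ← liftOp_conjTranspose, ← liftOp_mul (Function.injective_of_subsingleton _), this,
    liftOp_one]

lemma realizable_oneQubit (q : Q) {A : Matrix (Fin 2) (Fin 2) ℂ}
    (hA : A ∈ Matrix.unitaryGroup (Fin 2) ℂ) : Realizable (oneQubit q A) 1 :=
  Realizable.liftOp_unitary (Function.injective_of_subsingleton _) (by simp)
    (submatrix_mem_unitaryGroup hA)

/-- The diagonal unitary with the phase `exp (i θ)` on the basis states that agree with `x` on `T`,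
and `1` on all others. -/
def phaseOn (T : Finset Q) (x : Bits Q) (θ : ℝ) : Op Q :=
  Matrix.diagonal fun z => if ∀ q ∈ T, z q = x q then Complex.exp (θ * Complex.I) else 1

lemma exp_mul_I_mul_star (θ : ℝ) :
    Complex.exp (θ * Complex.I) * star (Complex.exp (θ * Complex.I)) = 1 := by
  rw [Complex.star_def, Complex.mul_conj, Complex.normSq_eq_norm_sq, Complex.norm_exp_ofReal_mul_I]
  simp

lemma realizable_phaseOn_empty (x : Bits Q) (θ : ℝ) : Realizable (phaseOn ∅ x θ) 1 := by
  have h := Realizable.liftOp_unitary (Q := Empty) (Q' := Q) (ι := Empty.elim)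
    (Function.injective_of_subsingleton _) (by simp)
    (A := Complex.exp (θ * Complex.I) • 1) (by
      rw [Matrix.mem_unitaryGroup_iff, star_smul, star_one, smul_mul_smul_comm, mul_one,
        exp_mul_I_mul_star, one_smul])
  rw [liftOp_smul, liftOp_one] at h
  convert h using 1
  simp [phaseOn, Matrix.smul_one_eq_diagonal]

lemma realizable_phaseOn_singleton (a : Q) (x : Bits Q) (θ : ℝ) :
    Realizable (phaseOn {a} x θ) 1 := by
  have h := realizable_oneQubit a
    (A := Matrix.diagonal fun i => if i = x a then Complex.exp (θ * Complex.I) else 1) (by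
      rw [Matrix.mem_unitaryGroup_iff, Matrix.star_eq_conjTranspose,
        Matrix.diagonal_conjTranspose, Matrix.diagonal_mul_diagonal, ← Matrix.diagonal_one]
      congr 1
      funext i
      simp only [Pi.star_apply]
      split_ifs
      · exact exp_mul_I_mul_star θ
      · simp)
  convert h using 1
  ext y z
  rw [oneQubit_apply]
  by_cases hyz : y = z
  · simp [hyz, phaseOn]
  · rw [phaseOn, Matrix.diagonal_apply_ne _ hyz]
    by_cases h1 : ∀ r, r ≠ a → y r = z r
    · rw [if_pos h1, Matrix.diagonal_apply_ne]
      refine fun h2 => hyz (funext fun r => ?_)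
      by_cases hr : r = a
      · rw [hr, h2]
      · exact h1 r hr
    · rw [if_neg h1]

/-- The identity `A B = (A + B - (A xor B)) / 2` for bits `A` and `B`, in the exponent. -/
lemma phaseOn_insert_insert {T : Finset Q} {a b : Q} (hab : a ≠ b) (hb : b ∉ T)
    (x : Bits Q) (θ : ℝ) :
    phaseOn (insert a (insert b T)) x θ =
      phaseOn (insert a T) x (θ / 2) * phaseOn (insert b T) x (θ / 2) *
        (cnot a b (x a) * phaseOn (insert b T) x (-(θ / 2)) * cnot a b (x a)) := by
  unfold phaseOn
  rw [cnot_conj_diagonal hab, Matrix.diagonal_mul_diagonal, Matrix.diagonal_mul_diagonal]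
  congr 1
  funext z
  have hT : (∀ q ∈ T, cnotMap a b (x a) z q = x q) ↔ ∀ q ∈ T, z q = x q :=
    forall₂_congr fun q hq => by rw [cnotMap_apply_of_ne (ne_of_mem_of_not_mem hq hb)]
  have hflip : z b + 1 = x b ↔ ¬ z b = x b := by
    generalize z b = s
    generalize x b = t
    revert s t
    decide
  have hsum : Complex.exp (θ * Complex.I) =
      Complex.exp ((θ / 2 : ℝ) * Complex.I) * Complex.exp ((θ / 2 : ℝ) * Complex.I) := by
    rw [← Complex.exp_add]
    congr 1
    push_cast
    ring
  have hcancel : Complex.exp ((θ / 2 : ℝ) * Complex.I) *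
      Complex.exp ((-(θ / 2) : ℝ) * Complex.I) = 1 := by
    rw [← Complex.exp_add, ← Complex.exp_zero]
    congr 1
    push_cast
    ring
  simp only [Finset.forall_mem_insert, Function.comp_apply, hT, cnotMap_apply_target]
  rw [hsum]
  generalize Complex.exp ((θ / 2 : ℝ) * Complex.I) = e at hcancel ⊢
  generalize Complex.exp ((-(θ / 2) : ℝ) * Complex.I) = e' at hcancel ⊢
  by_cases hR : ∀ q ∈ T, z q = x q
  · have hR' := eq_true hR
    have hA : (z a = x a) = True ∨ (z a = x a) = False := Classical.propComplete _
    have hB : (z b = x b) = True ∨ (z b = x b) = False := Classical.propComplete _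
    rcases hA with hA | hA <;> rcases hB with hB | hB <;>
      simp only [hR', hA, hB, hflip, hcancel, and_true, and_false, if_true, if_false, one_mul,
        mul_one, not_true_eq_false, not_false_eq_true]
  · simp [hR]

lemma realizable_phaseOn_insert {T : Finset Q} :
    ∀ a ∉ T, ∀ (x : Bits Q) (θ : ℝ), Realizable (phaseOn (insert a T) x θ) (5 ^ T.card) := by
  induction T using Finset.induction_on with
  | empty =>
    intro a _ x θ
    simpa using realizable_phaseOn_singleton a x θ
  | insert b T hb ih =>
    intro a ha x θ
    rw [Finset.mem_insert, not_or] at ha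
    rw [phaseOn_insert_insert ha.1 hb, Finset.card_insert_of_notMem hb]
    have hc := realizable_cnot ha.1 (x a)
    refine (((ih a ha.2 x _).mul (ih b hb x _)).mul ((hc.mul (ih b hb x _)).mul hc)).mono ?_
    have : 1 ≤ 5 ^ T.card := Nat.one_le_pow _ _ (by norm_num)
    rw [pow_succ]
    omega

lemma realizable_phaseOn (T : Finset Q) (x : Bits Q) (θ : ℝ) :
    Realizable (phaseOn T x θ) (5 ^ T.card) := by
  induction T using Finset.induction_on with
  | empty => simpa using realizable_phaseOn_empty x θ
  | insert a T ha _ =>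
    refine (realizable_phaseOn_insert a ha x θ).mono ?_
    rw [Finset.card_insert_of_notMem ha]
    exact Nat.pow_le_pow_right (by norm_num) (Nat.le_succ _)

lemma realizable_diagonal_update (x : Bits Q) {ω : ℂ} (hω : ‖ω‖ = 1) :
    Realizable (Matrix.diagonal (Function.update 1 x ω) : Op Q) (5 ^ Fintype.card Q) := by
  have h := realizable_phaseOn Finset.univ x ω.arg
  rw [Finset.card_univ] at h
  convert h using 1
  unfold phaseOn
  congr 1
  funext z
  have hexp : Complex.exp (ω.arg * Complex.I) = ω := by
    simpa [hω] using Complex.norm_mul_exp_arg_mul_I ω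
  simp only [Function.update_apply, Finset.mem_univ, forall_true_left, hexp, funext_iff,
    Pi.one_apply]

lemma realizable_diagonal (d : Bits Q → ℂ) (hd : ∀ x, ‖d x‖ = 1) :
    Realizable (Matrix.diagonal d : Op Q) (2 ^ Fintype.card Q * 5 ^ Fintype.card Q) := by
  have key : ∀ s : Finset (Bits Q), Realizable
      (Matrix.diagonal (fun x => if x ∈ s then d x else 1) : Op Q)
      (s.card * 5 ^ Fintype.card Q) := by
    intro s
    induction s using Finset.induction_on with
    | empty => simpa using Realizable.one
    | insert y s hy ih =>
      rw [Finset.card_insert_of_notMem hy, add_mul, one_mul]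
      have h := ih.mul (realizable_diagonal_update y (hd y))
      rw [Matrix.diagonal_mul_diagonal] at h
      convert h using 1
      congr 1
      funext x
      by_cases hx : x = y
      · subst hx
        simp [hy]
      · simp [hx]
  have h := key Finset.univ
  simpa using h

/-! ### Reflections supported on two basis states -/

/-- The reflection `1 - 2 |w⟩⟨w|`. It is meant for unit vectors `w`. -/
def reflection (w : Bits Q → ℂ) : Op Q :=
  1 - (2 : ℂ) • Matrix.vecMulVec w (star w)

lemma reflection_mulVec (w v : Bits Q → ℂ) :
    reflection w *ᵥ v = v - (2 * (star w ⬝ᵥ v)) • w := by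
  simp only [reflection, Matrix.sub_mulVec, Matrix.one_mulVec, Matrix.smul_mulVec,
    Matrix.vecMulVec_mulVec]
  congr 1
  ext i
  simp
  ring

lemma reflection_conjTranspose (w : Bits Q → ℂ) : (reflection w)ᴴ = reflection w := by
  simp [reflection, Matrix.conjTranspose_sub, Matrix.conjTranspose_smul,
    Matrix.conjTranspose_vecMulVec]

lemma reflection_mem_unitaryGroup {w : Bits Q → ℂ} (hw : star w ⬝ᵥ w = 1) :
    reflection w ∈ Matrix.unitaryGroup (Bits Q) ℂ := by
  rw [Matrix.mem_unitaryGroup_iff, Matrix.star_eq_conjTranspose, reflection_conjTranspose]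
  simp only [reflection, mul_sub, sub_mul, mul_one, one_mul, smul_mul_smul_comm,
    Matrix.vecMulVec_mul_vecMulVec, hw, one_smul]
  module

lemma conj_reflection {V : Op Q} (hV : V ∈ Matrix.unitaryGroup (Bits Q) ℂ) (w : Bits Q → ℂ) :
    V * reflection w * Vᴴ = reflection (V *ᵥ w) := by
  rw [Matrix.mem_unitaryGroup_iff, Matrix.star_eq_conjTranspose] at hV
  simp only [reflection, mul_sub, sub_mul, mul_one, hV, Matrix.mul_smul, Matrix.smul_mul,
    Matrix.mul_vecMulVec, Matrix.vecMulVec_mul, Matrix.star_mulVec]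

/-- The vector `α e_x + β e_y`. -/
def pairVec (x y : Bits Q) (α β : ℂ) : Bits Q → ℂ := Pi.single x α + Pi.single y β

lemma star_pairVec_dotProduct (x y : Bits Q) (α β : ℂ) (v : Bits Q → ℂ) :
    star (pairVec x y α β) ⬝ᵥ v = star α * v x + star β * v y := by
  simp only [pairVec, star_add, add_dotProduct, ← Pi.single_star, single_dotProduct]

lemma pairVec_normalized {x y : Bits Q} (hxy : x ≠ y) {α β : ℂ}
    (h : star α * α + star β * β = 1) :
    star (pairVec x y α β) ⬝ᵥ pairVec x y α β = 1 := by
  rw [star_pairVec_dotProduct, ← h]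
  simp [pairVec, hxy, hxy.symm]

/-- If the two basis states differ in one qubit only, then a rotation of that qubit turns the
reflection into a diagonal one. -/
lemma realizable_reflection_of_adjacent {x y : Bits Q} {q : Q} (hq : x q ≠ y q)
    (hxy : ∀ r, r ≠ q → x r = y r) {α β : ℂ} (h : star α * α + star β * β = 1) :
    Realizable (reflection (pairVec x y α β)) (5 ^ Fintype.card Q + 2) := by
  let B : Matrix (Fin 2) (Fin 2) ℂ := Matrix.of fun i j =>
    if j = x q then (if i = x q then α else β) else (if i = x q then -star β else star α)
  have hB : B ∈ Matrix.unitaryGroup (Fin 2) ℂ := by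
    have h' : star β * β + star α * α = 1 := by rw [add_comm, h]
    rw [Matrix.mem_unitaryGroup_iff', Matrix.star_eq_conjTranspose]
    ext i j
    rw [Matrix.mul_apply, Fin.sum_univ_two]
    simp only [B, Matrix.conjTranspose_apply, Matrix.of_apply]
    generalize x q = s
    fin_cases s <;> fin_cases i <;> fin_cases j <;>
      simp <;> simp at h h' <;> first | linear_combination h | linear_combination h' | ring
  have hphase := realizable_diagonal_update x (ω := -1) (by simp)
  have hdiag : (Matrix.diagonal (Function.update 1 x (-1)) : Op Q) =
      reflection (Pi.single x 1) := by
    ext y z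
    simp only [reflection, Matrix.sub_apply, Matrix.smul_apply, Matrix.vecMulVec_apply,
      Matrix.one_apply, Matrix.diagonal_apply, Function.update_apply, Pi.star_apply,
      Pi.single_apply]
    by_cases hyz : y = z
    · subst hyz
      by_cases hy : y = x
      · simp [hy]; norm_num
      · simp [hy]
    · by_cases hy : y = x
      · subst hy
        simp [hyz, Ne.symm hyz]
      · simp [hyz, hy]
  have hcol : oneQubit q B *ᵥ Pi.single x 1 = pairVec x y α β := by
    ext z
    rw [Matrix.mulVec_single_one, Matrix.col_apply, oneQubit_apply]
    have hne : x ≠ y := fun e => hq (by rw [e])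
    by_cases hz : z = x
    · subst hz
      simp [B, pairVec, hne]
    · by_cases hz' : z = y
      · subst hz'
        rw [if_pos fun r hr => (hxy r hr).symm]
        simp [B, pairVec, hne.symm, Ne.symm hq]
      · rw [if_neg]
        · simp [pairVec, hz, hz']
        · intro hr
          by_cases hzq : z q = x q
          · exact hz (funext fun r => if h : r = q then by rw [h, hzq] else hr r h)
          · refine hz' (funext fun r => ?_)
            by_cases h : r = q
            · rw [h]
              have : ∀ s t u : Fin 2, s ≠ t → u ≠ t → s = u := by decide
              exact this _ _ _ hzq (Ne.symm hq)
            · rw [hr r h, hxy r h]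
  have hU := oneQubit_mem_unitaryGroup q hB
  have hR := realizable_oneQubit q hB
  rw [hdiag] at hphase
  rw [← hcol, ← conj_reflection hU]
  exact ((hR.mul hphase).mul hR.conjTranspose).mono (by omega)

lemma swap_mulVec_pairVec {x y y' : Bits Q} (hxy : x ≠ y) (hxy' : x ≠ y') (hyy' : y ≠ y')
    (α β r : ℂ) (hr : 2 * (star r * r) = 1) :
    reflection (pairVec y y' r (-r)) *ᵥ pairVec x y' α β = pairVec x y α β := by
  rw [reflection_mulVec, star_pairVec_dotProduct]
  ext z
  simp only [pairVec, Pi.sub_apply, Pi.smul_apply, Pi.add_apply, smul_eq_mul, Pi.single_apply,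
    if_neg hxy.symm, if_neg hxy'.symm, if_neg hyy', if_true, star_neg]
  by_cases hz : z = x
  · subst hz
    simp [hxy, hxy']
  · by_cases hz1 : z = y
    · subst hz1
      simp only [hxy.symm, hyy', if_true, if_false]
      linear_combination β * hr
    · by_cases hz2 : z = y'
      · subst hz2
        simp only [hxy'.symm, hyy'.symm, if_true, if_false]
        linear_combination (-β) * hr
      · simp [hz, hz1, hz2]

/-- Basis states at Hamming distance `m` are brought together by swaps of adjacent basis states,
which are themselves reflections. -/
lemma realizable_reflection_of_card (m : ℕ) : ∀ {x y : Bits Q}, x ≠ y →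
    (Finset.univ.filter fun q => x q ≠ y q).card = m →
    ∀ {α β : ℂ}, star α * α + star β * β = 1 →
    Realizable (reflection (pairVec x y α β)) (2 * m * (5 ^ Fintype.card Q + 2)) := by
  induction m with
  | zero =>
    intro x y hxy hm
    refine (hxy (funext fun q => ?_)).elim
    by_contra hq
    rw [Finset.card_eq_zero, Finset.filter_eq_empty_iff] at hm
    exact hm (Finset.mem_univ q) hq
  | succ m ih =>
    intro x y hxy hm α β h
    obtain ⟨q, hq⟩ := Function.ne_iff.mp hxy
    by_cases hadj : ∀ r, r ≠ q → x r = y r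
    · refine (realizable_reflection_of_adjacent hq hadj h).mono ?_
      exact Nat.le_mul_of_pos_left _ (by omega)
    · let y' := Function.update y q (x q)
      have hxy' : x ≠ y' := by
        intro e
        refine hadj fun r hr => ?_
        rw [e]
        simp [y', hr]
      have hy'q : y q ≠ y' q := by simpa [y'] using Ne.symm hq
      have hyy' : y ≠ y' := fun e => hy'q (congrFun e q)
      have hm' : (Finset.univ.filter fun r => x r ≠ y' r).card = m := by
        have : (Finset.univ.filter fun r => x r ≠ y' r) =
            (Finset.univ.filter fun r => x r ≠ y r).erase q := by
          ext r
          by_cases hr : r = q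
          · subst hr
            simp [y']
          · simp [y', hr]
        rw [this, Finset.card_erase_of_mem (by simpa using hq), hm, Nat.add_sub_cancel]
      obtain ⟨r, hr⟩ : ∃ r : ℂ, 2 * (star r * r) = 1 := by
        refine ⟨((Real.sqrt (1 / 2) : ℝ) : ℂ), ?_⟩
        rw [Complex.star_def, Complex.conj_ofReal, ← Complex.ofReal_mul,
          Real.mul_self_sqrt (by norm_num)]
        norm_num
      have hr' : star r * r + star (-r) * (-r) = 1 := by
        rw [star_neg]
        linear_combination hr
      have hS := realizable_reflection_of_adjacent hy'q
        (fun s hs => by simp [y', hs]) hr'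
      have hSU := reflection_mem_unitaryGroup (pairVec_normalized hyy' hr')
      rw [← swap_mulVec_pairVec hxy hxy' hyy' α β r hr, ← conj_reflection hSU]
      refine ((hS.mul (ih hxy' hm' h)).mul hS.conjTranspose).mono (le_of_eq ?_)
      ring

lemma realizable_reflection_pairVec {x y : Bits Q} (hxy : x ≠ y) {α β : ℂ}
    (h : star α * α + star β * β = 1) :
    Realizable (reflection (pairVec x y α β))
      (2 * Fintype.card Q * (5 ^ Fintype.card Q + 2)) := by
  refine (realizable_reflection_of_card _ hxy rfl h).mono ?_
  gcongr
  exact Finset.card_le_univ _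

/-! ### Exact synthesis of arbitrary unitaries -/

/-- A Householder reflection of the plane that sends `(p, s)` to a multiple of `(1, 0)`. -/
lemma exists_householder (p s : ℂ) : ∃ α β : ℂ, star α * α + star β * β = 1 ∧
    s - 2 * (star α * p + star β * s) * β = 0 := by
  by_cases hs : s = 0
  · exact ⟨1, 0, by simp, by simp [hs]⟩
  -- the image `c` of `p` has the norm of `(p, s)`, and is a real multiple of `p`
  obtain ⟨c, hc, hcp⟩ : ∃ c : ℂ, star c * c = star p * p + star s * s ∧
      star c * p = star p * c := by
    have hn : ((Complex.normSq p + Complex.normSq s : ℝ) : ℂ) = star p * p + star s * s := by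
      push_cast
      rw [Complex.normSq_eq_conj_mul_self, Complex.normSq_eq_conj_mul_self]
      rfl
    have h0 : 0 ≤ Complex.normSq p + Complex.normSq s :=
      add_nonneg (Complex.normSq_nonneg _) (Complex.normSq_nonneg _)
    set R := Real.sqrt (Complex.normSq p + Complex.normSq s) with hR
    have hRR : (R : ℂ) * R = star p * p + star s * s := by
      rw [← hn, ← Complex.ofReal_mul, Real.mul_self_sqrt h0]
    have hstar : star (R : ℂ) = R := Complex.conj_ofReal R
    by_cases hp : p = 0
    · exact ⟨R, by rw [hstar, hRR], by simp [hp]⟩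
    · have hu : star (Complex.exp (p.arg * Complex.I)) * Complex.exp (p.arg * Complex.I) = 1 := by
        rw [mul_comm, exp_mul_I_mul_star]
      have hpe : p = ‖p‖ * Complex.exp (p.arg * Complex.I) :=
        (Complex.norm_mul_exp_arg_mul_I p).symm
      generalize Complex.exp (p.arg * Complex.I) = e at hu hpe
      refine ⟨R * e, ?_, ?_⟩
      · rw [star_mul', hstar, ← hRR]
        linear_combination (R : ℂ) * R * hu
      · have : star ((‖p‖ : ℝ) : ℂ) = (‖p‖ : ℝ) := Complex.conj_ofReal _
        rw [star_mul', hstar, hpe]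
        generalize ((‖p‖ : ℝ) : ℂ) = t at this
        rw [star_mul', this]
        ring
  set D := Complex.normSq (p - c) + Complex.normSq s with hD
  have hDpos : 0 < D := add_pos_of_nonneg_of_pos (Complex.normSq_nonneg _) (Complex.normSq_pos.2 hs)
  have hDc : (D : ℂ) = star (p - c) * (p - c) + star s * s := by
    rw [hD]
    push_cast
    rw [Complex.normSq_eq_conj_mul_self, Complex.normSq_eq_conj_mul_self]
    rfl
  obtain ⟨r, hr, hrD⟩ : ∃ r : ℂ, star r = r ∧ r * r * D = 1 := by
    refine ⟨((Real.sqrt D⁻¹ : ℝ) : ℂ), Complex.conj_ofReal _, ?_⟩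
    rw [← Complex.ofReal_mul, Real.mul_self_sqrt (inv_nonneg.2 hDpos.le), ← Complex.ofReal_mul,
      inv_mul_cancel₀ hDpos.ne', Complex.ofReal_one]
  refine ⟨r * (p - c), r * s, ?_, ?_⟩
  · rw [star_mul', star_mul', hr, ← hrD, hDc]
    ring
  · rw [star_mul', star_mul', hr]
    rw [hDc] at hrD
    rw [star_sub] at hrD ⊢
    linear_combination (-s) * hrD + s * r * r * hcp + s * r * r * hc

/-- Householder reflections in coordinate planes move the coordinates of `v` in `s` into the
coordinate `y`, and leave all other coordinates alone. -/
lemma exists_elimination {N : ℕ}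
    (hN : ∀ {x y : Bits Q}, x ≠ y → ∀ {α β : ℂ}, star α * α + star β * β = 1 →
      Realizable (reflection (pairVec x y α β)) N)
    (y : Bits Q) (s : Finset (Bits Q)) (hy : y ∉ s) (v : Bits Q → ℂ) :
    ∃ W : Op Q, Realizable W (s.card * N) ∧ W ∈ Matrix.unitaryGroup (Bits Q) ℂ ∧
      (∀ u : Bits Q → ℂ, (∀ z ∈ insert y s, u z = 0) → W *ᵥ u = u) ∧
      (∀ z ∈ s, (W *ᵥ v) z = 0) ∧ ∀ z ∉ insert y s, (W *ᵥ v) z = v z := by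
  induction s using Finset.induction_on with
  | empty =>
    exact ⟨1, by simpa using Realizable.one, one_mem _, by simp, by simp, by simp⟩
  | insert a s ha ih =>
    rw [Finset.mem_insert, not_or] at hy
    obtain ⟨W, hW, hWU, hfix, hzero, hrest⟩ := ih hy.2
    obtain ⟨α, β, hαβ, hkill⟩ := exists_householder ((W *ᵥ v) y) ((W *ᵥ v) a)
    have happ : ∀ (u : Bits Q → ℂ) (z : Bits Q), (reflection (pairVec y a α β) *ᵥ u) z =
        u z - 2 * (star α * u y + star β * u a) * pairVec y a α β z := by
      intro u z
      rw [reflection_mulVec, star_pairVec_dotProduct]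
      rfl
    have hoff : ∀ z, z ≠ y → z ≠ a → pairVec y a α β z = 0 := fun z h1 h2 => by
      simp [pairVec, h1, h2]
    refine ⟨reflection (pairVec y a α β) * W, ?_,
      mul_mem (reflection_mem_unitaryGroup (pairVec_normalized hy.1 hαβ)) hWU, ?_, ?_, ?_⟩
    · rw [Finset.card_insert_of_notMem ha, add_mul, one_mul, add_comm]
      exact (hN hy.1 hαβ).mul hW
    · intro u hu
      rw [← Matrix.mulVec_mulVec, hfix u fun z hz => hu z (by
        rw [Finset.mem_insert] at hz ⊢
        exact hz.imp_right (Finset.mem_insert_of_mem))]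
      ext z
      rw [happ, hu y (by simp), hu a (by simp)]
      simp
    · intro z hz
      rw [← Matrix.mulVec_mulVec, happ]
      rw [Finset.mem_insert] at hz
      rcases hz with rfl | hz
      · rw [← hkill]
        simp [pairVec, Ne.symm hy.1]
      · rw [hzero z hz, hoff z (ne_of_mem_of_not_mem hz hy.2) (ne_of_mem_of_not_mem hz ha)]
        simp
    · intro z hz
      simp only [Finset.mem_insert, not_or] at hz
      rw [← Matrix.mulVec_mulVec, happ, hoff z hz.1 hz.2.1, mul_zero, sub_zero, hrest z]
      simp [hz]

lemma norm_apply_self_of_column {U : Op Q} (hU : U ∈ Matrix.unitaryGroup (Bits Q) ℂ) {z : Bits Q}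
    (hz : ∀ x, x ≠ z → U x z = 0) : star (U z z) * U z z = 1 := by
  rw [Matrix.mem_unitaryGroup_iff', Matrix.star_eq_conjTranspose] at hU
  have h := congrFun (congrFun hU z) z
  rw [Matrix.mul_apply, Finset.sum_eq_single z (fun x _ hx => by rw [hz x hx, mul_zero])
    (by simp)] at h
  simpa using h

/-- A unitary one of whose columns is a multiple of a basis vector has the corresponding row of the
same kind. -/
lemma row_eq_zero_of_column {U : Op Q} (hU : U ∈ Matrix.unitaryGroup (Bits Q) ℂ) {z : Bits Q}
    (hz : ∀ x, x ≠ z → U x z = 0) {y : Bits Q} (hy : y ≠ z) : U z y = 0 := by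
  have h1 := norm_apply_self_of_column hU hz
  rw [Matrix.mem_unitaryGroup_iff', Matrix.star_eq_conjTranspose] at hU
  have h := congrFun (congrFun hU z) y
  rw [Matrix.mul_apply, Finset.sum_eq_single z (fun x _ hx => by
    rw [Matrix.conjTranspose_apply, hz x hx, star_zero, zero_mul]) (by simp),
    Matrix.one_apply_ne hy.symm, Matrix.conjTranspose_apply] at h
  rcases mul_eq_zero.1 h with h | h
  · rw [h, zero_mul] at h1
    exact (zero_ne_one h1).elim
  · exact h

/-- Elimination column by column; the columns outside `s` are already diagonal. -/
lemma realizable_of_diagonal_columns {N M : ℕ}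
    (hN : ∀ {x y : Bits Q}, x ≠ y → ∀ {α β : ℂ}, star α * α + star β * β = 1 →
      Realizable (reflection (pairVec x y α β)) N)
    (hM : ∀ d : Bits Q → ℂ, (∀ x, ‖d x‖ = 1) → Realizable (Matrix.diagonal d : Op Q) M)
    (s : Finset (Bits Q)) : ∀ U ∈ Matrix.unitaryGroup (Bits Q) ℂ,
      (∀ z ∉ s, ∀ x, x ≠ z → U x z = 0) →
      Realizable U (s.card * (2 ^ Fintype.card Q * N) + M) := by
  induction s using Finset.induction_on with
  | empty =>
    intro U hU hcol
    have hdiag : U = Matrix.diagonal fun z => U z z := by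
      ext x z
      rw [Matrix.diagonal_apply]
      split_ifs with h
      · rw [h]
      · exact hcol z (by simp) x h
    rw [hdiag, Finset.card_empty, zero_mul, zero_add]
    refine hM _ fun z => ?_
    have h := norm_apply_self_of_column hU (hcol z (by simp))
    rw [Complex.star_def, ← Complex.normSq_eq_conj_mul_self, Complex.normSq_eq_norm_sq] at h
    have h' : ‖U z z‖ ^ 2 = 1 := by exact_mod_cast h
    exact (pow_eq_one_iff_of_nonneg (norm_nonneg _) two_ne_zero).1 h'
  | insert y s hy ih =>
    intro U hU hcol
    obtain ⟨W, hW, hWU, hfix, hzero, hrest⟩ := exists_elimination hN y s hy (fun x => U x y)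
    have hWcol : ∀ x z, (W * U) x z = (W *ᵥ fun x => U x z) x := fun x z => rfl
    have h := ih (W * U) (mul_mem hWU hU) (by
      intro z hz x hx
      rw [hWcol]
      by_cases hzy : z = y
      · subst hzy
        by_cases hxs : x ∈ s
        · exact hzero x hxs
        · have hx' : x ∉ insert z s := by simp [hx, hxs]
          rw [hrest x hx']
          exact row_eq_zero_of_column hU (hcol x hx') (Ne.symm hx)
      · have hz' : z ∉ insert y s := by simp [hzy, hz]
        rw [hfix]
        · exact hcol z hz' x hx
        · intro t ht
          exact hcol z hz' t (ne_of_mem_of_not_mem ht hz'))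
    have hUW : U = Wᴴ * (W * U) := by
      rw [Matrix.mem_unitaryGroup_iff', Matrix.star_eq_conjTranspose] at hWU
      rw [← mul_assoc, hWU, one_mul]
    rw [hUW]
    refine (hW.conjTranspose.mul h).mono ?_
    have hs : s.card ≤ 2 ^ Fintype.card Q := by
      simpa using Finset.card_le_univ s
    rw [Finset.card_insert_of_notMem hy, add_mul, one_mul]
    have := Nat.mul_le_mul_right N hs
    omega

/-- Every unitary on `k` qubits is implemented exactly, without ancillas, by a circuit whose number
of gates is exponential in `k`. -/
theorem realizable_of_unitary {U : Op Q} (hU : U ∈ Matrix.unitaryGroup (Bits Q) ℂ) :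
    Realizable U (7 * 40 ^ Fintype.card Q) := by
  refine (realizable_of_diagonal_columns realizable_reflection_pairVec realizable_diagonal
    Finset.univ U hU (by simp)).mono ?_
  rw [Finset.card_univ, Fintype.card_fun, Fintype.card_fin]
  generalize Fintype.card Q = k
  have h1 : k ≤ 2 ^ k := Nat.lt_two_pow_self.le
  have h2 : 5 ^ k + 2 ≤ 3 * 5 ^ k := by
    have := Nat.one_le_pow k 5 (by norm_num)
    omega
  have h3 : (40 : ℕ) ^ k = 2 ^ k * (2 ^ k * (2 ^ k * 5 ^ k)) := by
    simp only [← mul_pow]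
    norm_num
  have h4 : 2 ^ k * 5 ^ k ≤ 40 ^ k := by
    rw [← mul_pow]
    exact Nat.pow_le_pow_left (by norm_num) k
  calc 2 ^ k * (2 ^ k * (2 * k * (5 ^ k + 2))) + 2 ^ k * 5 ^ k
      ≤ 2 ^ k * (2 ^ k * (2 * 2 ^ k * (3 * 5 ^ k))) + 40 ^ k := by gcongr
    _ = 7 * 40 ^ k := by
      rw [h3]
      ring

/-! ### Time evolution -/

lemma liftOp_exp {ι : Q → Q'} (hι : ι.Injective) (A : Op Q) :
    liftOp ι (NormedSpace.exp A) = NormedSpace.exp (liftOp ι A) := by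
  let _ : NormedRing (Op Q) := Matrix.linftyOpNormedRing
  let _ : NormedAlgebra ℂ (Op Q) := Matrix.linftyOpNormedAlgebra
  let _ : NormedRing (Op Q') := Matrix.linftyOpNormedRing
  let _ : NormedAlgebra ℂ (Op Q') := Matrix.linftyOpNormedAlgebra
  let _ : NormedAlgebra ℚ (Op Q) := NormedAlgebra.restrictScalars ℚ ℂ _
  exact NormedSpace.map_exp (liftOpHom hι)
    (LinearMap.continuous_of_finiteDimensional (liftOpHom hι).toLinearMap) A

lemma exp_mem_unitaryGroup {A : Op Q} (hA : A.IsHermitian) (t : ℝ) :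
    NormedSpace.exp ((-(Complex.I * (t : ℂ))) • A) ∈ Matrix.unitaryGroup (Bits Q) ℂ := by
  have hstar : ((-(Complex.I * (t : ℂ))) • A)ᴴ = -((-(Complex.I * (t : ℂ))) • A) := by
    rw [Matrix.conjTranspose_smul, hA.eq, ← neg_smul]
    congr 1
    simp
  have hcomm := (Commute.refl ((-(Complex.I * (t : ℂ))) • A)).neg_right
  rw [Matrix.mem_unitaryGroup_iff, Matrix.star_eq_conjTranspose, ← Matrix.exp_conjTranspose, hstar,
    ← Matrix.exp_add_of_commute _ _ hcomm, add_neg_cancel, NormedSpace.exp_zero]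

/-- The evolution under a Hermitian operator on the qubits in `S` costs a number of gates that is
exponential in the size of `S` only. -/
lemma realizable_exp_localOp (S : Finset Q) {A : Op {q : Q // q ∈ S}} (hA : A.IsHermitian)
    (t : ℝ) : Realizable (NormedSpace.exp ((-(Complex.I * (t : ℂ))) • localOp S A))
      (7 * 40 ^ S.card) := by
  rw [localOp_eq_liftOp, ← liftOp_smul, ← liftOp_exp Subtype.val_injective]
  simpa using (realizable_of_unitary (exp_mem_unitaryGroup hA t)).liftOp Subtype.val_injective

lemma exists_isHermitian_localOp_sum {J : Type*} (S : Finset Q) (s : Finset J) (h : J → Op Q)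
    (hherm : ∀ j, (h j).IsHermitian) (hact : ∀ j ∈ s, ActsOn S (h j)) :
    ∃ A : Op {q : Q // q ∈ S}, A.IsHermitian ∧ ∑ j ∈ s, h j = localOp S A := by
  choose! A hA using hact
  have hsum : ∑ j ∈ s, h j = liftOp Subtype.val (∑ j ∈ s, A j) := by
    rw [← show liftOpHom Subtype.val_injective (∑ j ∈ s, A j) =
      liftOp Subtype.val (∑ j ∈ s, A j) from rfl, map_sum]
    exact Finset.sum_congr rfl fun j hj => (hA j hj).trans (localOp_eq_liftOp S _)
  refine ⟨∑ j ∈ s, A j, ?_, by rw [hsum, localOp_eq_liftOp]⟩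
  apply liftOp_injective Subtype.val_injective
  rw [liftOp_conjTranspose, ← hsum, Matrix.conjTranspose_sum]
  exact Finset.sum_congr rfl fun j _ => (hherm j).eq

/-- The evolution under a sum of commuting local terms is the product, over the different supports,
of the evolutions under the terms with that support. -/
lemma CommutingLocal.realizable_evolution {n k : ℕ} {H : Op (Fin n)} (D : CommutingLocal H k)
    (t : ℝ) : Realizable (evolution H t) (D.numSupports * (7 * 40 ^ min k n)) := by
  classical
  let G : Finset (Fin n) → Op (Fin n) := fun S =>
    ∑ j ∈ Finset.univ.filter (fun j => D.supp j = S), D.term j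
  have hcomm : ∀ S S', Commute (G S) (G S') := fun S S' =>
    Commute.sum_left _ _ _ fun i _ => Commute.sum_right _ _ _ fun j _ => D.commute i j
  have hH : H = ∑ S ∈ Finset.univ.image D.supp, G S := by
    refine D.sum_eq.trans (Finset.sum_fiberwise_of_maps_to
      (fun j _ => Finset.mem_image_of_mem _ (Finset.mem_univ j)) _).symm
  have key : ∀ s ⊆ Finset.univ.image D.supp,
      Realizable (NormedSpace.exp ((-(Complex.I * (t : ℂ))) • ∑ S ∈ s, G S))
        (s.card * (7 * 40 ^ min k n)) := by
    intro s
    induction s using Finset.induction_on with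
    | empty =>
      intro _
      simpa using Realizable.one
    | insert S s hS ih =>
      intro hs
      rw [Finset.insert_subset_iff] at hs
      obtain ⟨j, -, hj⟩ := Finset.mem_image.1 hs.1
      obtain ⟨A, hA, hGA⟩ := exists_isHermitian_localOp_sum S
        (Finset.univ.filter fun j => D.supp j = S) D.term D.isHermitian fun j hj => by
          rw [← (Finset.mem_filter.1 hj).2]
          exact D.actsOn j
      have hcard : S.card ≤ min k n :=
        le_min (hj ▸ D.card_supp j) (by simpa using Finset.card_le_univ S)
      have hgate : Realizable (NormedSpace.exp ((-(Complex.I * (t : ℂ))) • G S))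
          (7 * 40 ^ min k n) := by
        have h := realizable_exp_localOp S hA t
        rw [← hGA] at h
        exact h.mono (Nat.mul_le_mul_left _ (Nat.pow_le_pow_right (by norm_num) hcard))
      rw [Finset.sum_insert hS, smul_add, Matrix.exp_add_of_commute _ _
        (((Commute.sum_right _ _ _ fun S' _ => hcomm S S').smul_left _).smul_right _),
        Finset.card_insert_of_notMem hS, add_mul, one_mul, add_comm]
      exact hgate.mul (ih hs.2)
  have h := key _ subset_rfl
  unfold evolution
  exact (congrArg (fun K => NormedSpace.exp ((-(Complex.I * (t : ℂ))) • K)) hH) ▸ h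

/-- An exponential in `k = O(log n)` is polynomially bounded in `n`. -/
lemma exists_polynomial_bound {k : ℕ → ℕ}
    (hk : (fun n => (k n : ℝ)) =O[Filter.atTop] (fun n : ℕ => Real.log (n : ℝ))) :
    ∃ p : Polynomial ℕ, ∀ n, 40 ^ min (k n) n ≤ p.eval n := by
  obtain ⟨c, hc⟩ := hk.bound
  obtain ⟨n₀, hn₀⟩ := Filter.eventually_atTop.1 hc
  obtain ⟨r, hr⟩ := exists_nat_ge (c * Real.log 40)
  refine ⟨Polynomial.X ^ r + Polynomial.C (40 ^ (n₀ + 1)), fun n => ?_⟩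
  rw [Polynomial.eval_add, Polynomial.eval_pow, Polynomial.eval_X, Polynomial.eval_C]
  rcases le_or_gt n (n₀ + 1) with hn | hn
  · exact (Nat.pow_le_pow_right (by norm_num) ((min_le_right _ _).trans hn)).trans
      (Nat.le_add_left _ _)
  · refine le_trans ?_ (Nat.le_add_right _ _)
    refine (Nat.pow_le_pow_right (by norm_num) (min_le_left _ _)).trans ?_
    have hn1 : (1 : ℝ) ≤ n := by exact_mod_cast (by omega : 1 ≤ n)
    have hn0 : (0 : ℝ) < n := by linarith
    have hlog : 0 ≤ Real.log n := Real.log_nonneg hn1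
    have h40 : 0 ≤ Real.log 40 := Real.log_nonneg (by norm_num)
    have hkn : (k n : ℝ) ≤ c * Real.log n := by
      have h := hn₀ n (by omega)
      rwa [Real.norm_of_nonneg (Nat.cast_nonneg _), Real.norm_of_nonneg hlog] at h
    have hreal : (40 : ℝ) ^ k n ≤ (n : ℝ) ^ r := by
      rw [← Real.log_le_log_iff (by positivity) (by positivity), Real.log_pow, Real.log_pow]
      calc (k n : ℝ) * Real.log 40 ≤ c * Real.log n * Real.log 40 := by gcongr
        _ = c * Real.log 40 * Real.log n := by ring
        _ ≤ r * Real.log n := by gcongr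
    exact_mod_cast hreal

end FastForward
end

theorem theorem5p1
    (H : ∀ n : ℕ, FastForward.Op (Fin n)) (k : ℕ → ℕ)
    (hnorm : ∀ n, FastForward.opNorm (H n) = 1)
    (D : ∀ n, FastForward.CommutingLocal (H n) (k n))
    (hk : (fun n => (k n : ℝ)) =O[Filter.atTop] (fun n : ℕ => Real.log (n : ℝ)))
    (hD : ∃ q : Polynomial ℕ, ∀ n, (D n).numSupports ≤ q.eval n)
    (T : ℕ → ℝ) (hT : FastForward.ExpLarge T)
    (α : ℕ → ℝ) (hα : FastForward.ExpSmall α) :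
    FastForward.FastForwardable H T α := by
  obtain ⟨q, hq⟩ := hD
  obtain ⟨p, hp⟩ := FastForward.exists_polynomial_bound hk
  refine ⟨q * (Polynomial.C 7 * p), fun n t _ _ => ⟨0, Nat.zero_le _, ?_⟩⟩
  obtain ⟨U, hU, hUop⟩ := ((D n).realizable_evolution t).liftOp
    (Sum.inl_injective (β := Fin 0))
  refine ⟨U, hU.trans ?_, fun ψ _ => ?_⟩
  · rw [Polynomial.eval_mul, Polynomial.eval_mul, Polynomial.eval_C]
    exact Nat.mul_le_mul (hq n) (Nat.mul_le_mul_left _ (hp n))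
  · -- the circuit implements the evolution exactly
    rw [hUop, FastForward.withAncilla_zero_eq_liftOp, sub_self]
    simpa [FastForward.applyOp] using (hα.1 n).le
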